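/- Let $a\in\mathbb{R}$ and let $M:\mathbb{R}\to\mathbb{R}$ be a function of class $C^3$ (for example, smooth). On the coordinate domain $(v,r,\vartheta,\psi)$ with $v\in\mathbb{R}$, $r>0$, $0<\vartheta<\pi$ and $\psi$ an angle, put $\rho^2=r^2+a^2\cos^2\vartheta$, $\Delta=r^2-2M(v)r+a^2$, $\Gamma=r^2+a^2$, and let $g$ be the Kerr-Vaidya metric $$ds^2=-\Big(1-\frac{2M(v)r}{\rho^2}\Big)dv^2+2\,dv\,dr-\frac{4M(v)ar\sin^2\vartheta}{\rho^2}\,dv\,d\psi-2a\sin^2\vartheta\,dr\,d\psi+\rho^2\,d\vartheta^2+\frac{\Gamma^2-\Delta a^2\sin^2\vartheta}{\rho^2}\sin^2\vartheta\,d\psi^2 .$$ Let $\nabla$ be its Levi-Civita connection and $G_{ab}=R_{ab}-\tfrac12 R\,g_{ab}$ its Einstein tensor. Then the vector field $K^a=(\partial/\partial v)^a$ generates a Kodama-like time translation symmetry, that is: 1. $K^a$ is divergence-free, $\nabla_aK^a=0$; 2. $K^a$ is tangent to the surfaces of constant $r$, $K^a\nabla_a r=0$; 3. the current $J^a=G^{ab}K_b$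 is differentiable and covariantly conserved, $\nabla_aJ^a=0$. The components of the current are $$J^v=\frac{1}{\rho^6}\,a^2\sin^2\vartheta\,(a^2\cos^2\vartheta-r^2)\,M'(v),$$ $$J^r=\frac{1}{\rho^6}\Big(\big(\rho^4+r^4+r^2a^2\sin^2\vartheta-a^4\cos^2\vartheta\big)M'(v)-r\rho^2a^2\sin^2\vartheta\,M''(v)\Big),$$ $$J^\vartheta=-\frac{1}{\rho^6}\,r\,a^2\sin(2\vartheta)\,M'(v),$$ $$J^\psi=\frac{1}{\rho^6}\,a\,(a^2\cos^2\vartheta-r^2)\,M'(v).$$ Moreover $K^a$ is timelike, i.e. $g_{ab}K^aK^b<0$, exactly at the points where $2M(v)r<\rho^2$. -/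

import Mathlib

open scoped Matrix

noncomputable section

namespace KerrVaidya

/-! Tensor calculus in a coordinate chart with four coordinates. -/

/-- Points of a coordinate chart; here the coordinates are `(v, r, ϑ, ψ) = (x 0, x 1, x 2, x 3)`. -/
abbrev Coord : Type := Fin 4 → ℝ

/-- Components `g_{μν}` of a metric as functions of the coordinates. -/
abbrev Metric : Type := Coord → Matrix (Fin 4) (Fin 4) ℝ

/-- Contravariant components `V^μ` of a vector field. -/
abbrev VField : Type := Coord → Fin 4 → ℝ

/-- The partial derivative `∂_μ f` at `x`. -/
def pd (μ : Fin 4) (f : Coord → ℝ) (x : Coord) : ℝ :=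
  deriv (fun t => f (Function.update x μ t)) (x μ)

/-- The inverse metric `g^{μν}`. -/
def invMetric (g : Metric) (x : Coord) : Matrix (Fin 4) (Fin 4) ℝ := (g x)⁻¹

/-- Christoffel symbols of the Levi-Civita connection,
`Γ^l_{μν} = ½ g^{lk} (∂_μ g_{kν} + ∂_ν g_{kμ} - ∂_k g_{μν})`. -/
def christoffel (g : Metric) (l μ ν : Fin 4) (x : Coord) : ℝ :=
  (1 / 2) * ∑ k, invMetric g x l k *
    (pd μ (fun y => g y k ν) x + pd ν (fun y => g y k μ) x - pd k (fun y => g y μ ν) x)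

/-- Curvature tensor
`R^p_{σμν} = ∂_μ Γ^p_{νσ} - ∂_ν Γ^p_{μσ} + Γ^p_{μl} Γ^l_{νσ} - Γ^p_{νl} Γ^l_{μσ}`. -/
def riemann (g : Metric) (p σ μ ν : Fin 4) (x : Coord) : ℝ :=
  pd μ (christoffel g p ν σ) x - pd ν (christoffel g p μ σ) x
    + ∑ l, (christoffel g p μ l x * christoffel g l ν σ x
      - christoffel g p ν l x * christoffel g l μ σ x)

/-- Ricci tensor `R_{μν} = R^p_{μpν}`. -/
def ricci (g : Metric) (μ ν : Fin 4) (x : Coord) : ℝ :=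
  ∑ p, riemann g p μ p ν x

/-- Scalar curvature `R = g^{μν} R_{μν}`. -/
def scalarCurv (g : Metric) (x : Coord) : ℝ :=
  ∑ μ, ∑ ν, invMetric g x μ ν * ricci g μ ν x

/-- Einstein tensor `G_{μν} = R_{μν} - ½ R g_{μν}`. -/
def einstein (g : Metric) (μ ν : Fin 4) (x : Coord) : ℝ :=
  ricci g μ ν x - (1 / 2) * scalarCurv g x * g x μ ν

/-- Einstein tensor with raised indices, `G^{μν} = g^{μα} g^{νβ} G_{αβ}`. -/
def einsteinUp (g : Metric) (μ ν : Fin 4) (x : Coord) : ℝ :=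
  ∑ α, ∑ β, invMetric g x μ α * invMetric g x ν β * einstein g α β x

/-- The covector `V_μ = g_{μν} V^ν`. -/
def lower (g : Metric) (V : VField) (μ : Fin 4) (x : Coord) : ℝ :=
  ∑ ν, g x μ ν * V x ν

/-- The current `J^μ = G^{μν} V_ν` associated with a vector field `V`. -/
def current (g : Metric) (V : VField) : VField :=
  fun x μ => ∑ ν, einsteinUp g μ ν x * lower g V ν x

/-- Covariant derivative `∇_μ V^ν = ∂_μ V^ν + Γ^ν_{μl} V^l`. -/
def covDeriv (g : Metric) (V : VField) (μ ν : Fin 4) (x : Coord) : ℝ :=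
  pd μ (fun y => V y ν) x + ∑ l, christoffel g ν μ l x * V x l

/-- Covariant divergence `∇_μ V^μ`. -/
def divergence (g : Metric) (V : VField) (x : Coord) : ℝ :=
  ∑ μ, covDeriv g V μ μ x

/-- The derivative `V^μ ∂_μ f` of a scalar function along a vector field. -/
def along (V : VField) (f : Coord → ℝ) (x : Coord) : ℝ :=
  ∑ μ, V x μ * pd μ f x

/-- The square `g_{μν} V^μ V^ν`. -/
def normSq (g : Metric) (V : VField) (x : Coord) : ℝ :=
  ∑ μ, ∑ ν, g x μ ν * V x μ * V x ν

/-! The Kerr-Vaidya metric in ingoing coordinates `(v, r, ϑ, ψ)`. -/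

/-- `ρ² = r² + a² cos² ϑ`. -/
def rhoSq (a : ℝ) (x : Coord) : ℝ := x 1 ^ 2 + a ^ 2 * Real.cos (x 2) ^ 2

/-- `Δ = r² - 2 M(v) r + a²`. -/
def Delta (a : ℝ) (M : ℝ → ℝ) (x : Coord) : ℝ := x 1 ^ 2 - 2 * M (x 0) * x 1 + a ^ 2

/-- `Γ = r² + a²`. -/
def Gam (a : ℝ) (x : Coord) : ℝ := x 1 ^ 2 + a ^ 2

/-- The coordinate domain `r > 0`, `0 < ϑ < π`. The coordinate `v` is any real number, and so is
the angle `ψ` (nothing depends on it, and it may be taken modulo `2π`). -/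
def domain : Set Coord := {x | 0 < x 1 ∧ 0 < x 2 ∧ x 2 < Real.pi}

/-- The Kerr-Vaidya metric with rotation parameter `a` and mass function `M`:
`ds² = -(1 - 2Mr/ρ²) dv² + 2 dv dr - (4Mar sin²ϑ/ρ²) dv dψ - 2a sin²ϑ dr dψ + ρ² dϑ²
  + ((Γ² - Δ a² sin²ϑ)/ρ²) sin²ϑ dψ²`. -/
def metric (a : ℝ) (M : ℝ → ℝ) : Metric := fun x =>
  !![-(1 - 2 * M (x 0) * x 1 / rhoSq a x), 1, 0,
        -(2 * M (x 0) * a * x 1 * Real.sin (x 2) ^ 2 / rhoSq a x);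
     1, 0, 0, -(a * Real.sin (x 2) ^ 2);
     0, 0, rhoSq a x, 0;
     -(2 * M (x 0) * a * x 1 * Real.sin (x 2) ^ 2 / rhoSq a x),
        -(a * Real.sin (x 2) ^ 2), 0,
        (Gam a x ^ 2 - Delta a M x * a ^ 2 * Real.sin (x 2) ^ 2) / rhoSq a x
          * Real.sin (x 2) ^ 2]

/-- The coordinate vector field `K = ∂/∂v`. -/
def K : VField := fun _ => Pi.single 0 1

/-- The determinant is `-(ρ² sin ϑ)²`, so that the metric is non-degenerate on `domain` and
`invMetric` is its inverse there. -/
theorem det_metric (a : ℝ) (M : ℝ → ℝ) (x : Coord) (hx : x ∈ domain) :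
    (metric a M x).det = -(rhoSq a x * Real.sin (x 2)) ^ 2 := by
  have hr : x 1 ^ 2 + a ^ 2 * Real.cos (x 2) ^ 2 ≠ 0 := by
    have := hx.1
    positivity
  have hc : Real.sin (x 2) ^ 2 = 1 - Real.cos (x 2) ^ 2 := Real.sin_sq (x 2)
  have hr' : rhoSq a x ≠ 0 := hr
  have hG : Gam a x = rhoSq a x + a ^ 2 * Real.sin (x 2) ^ 2 := by
    simp only [Gam, rhoSq, hc]; ring
  have hD : Delta a M x = rhoSq a x + a ^ 2 * Real.sin (x 2) ^ 2 - 2 * M (x 0) * x 1 := by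
    simp only [Delta, rhoSq, hc]; ring
  rw [metric, hG, hD, Matrix.det_succ_row_zero]
  simp [Fin.sum_univ_succ, Matrix.det_fin_three, Fin.succAbove]
  field_simp
  ring

end KerrVaidya

end

/-! Every quantity involved is a polynomial in r, cos ϑ, sin ϑ, 1/ρ², cot ϑ, M, M' and M'', so the
curvature is computed by reflection on such expressions. By `pd_eq_grad`, a function given by an
expression on the open domain has the formal derivatives of that expression as its partial
derivatives. Closed forms of the inverse metric, the Christoffel symbols and the Ricci tensor are
checked one level at a time, so only first derivatives of explicit expressions are ever taken.

The scalar curvature vanishes, so the current is the raised Ricci tensor contracted with K. Both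
divergences follow from ∇_μ V^μ = ∂_μ V^μ + V^μ ∂_μ log(ρ² sin ϑ); for the current, the M' and M''
terms cancel identically. -/

noncomputable section

namespace KerrVaidya

/-! ### Expressions and formal derivatives -/

/-- Polynomial expressions in the functions `r`, `cos ϑ`, `sin ϑ`, `1 / ρ²`, `cot ϑ`, `M`, `M'`
and `M''` of the coordinates. -/
inductive Scalar : Type
  | const (q : ℝ)
  | r | c | s | w | k | m | m' | m''
  | add (p q : Scalar)
  | mul (p q : Scalar)
  | neg (p : Scalar)
  | pow (p : Scalar) (n : ℕ)

namespace Scalar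

instance : Zero Scalar := ⟨const 0⟩
instance : One Scalar := ⟨const 1⟩
instance : Add Scalar := ⟨add⟩
instance : Mul Scalar := ⟨mul⟩
instance : Neg Scalar := ⟨neg⟩
instance : Sub Scalar := ⟨fun p q => add p (neg q)⟩
instance : Pow Scalar ℕ := ⟨pow⟩

/-- The value of an expression at a point. -/
def val (a : ℝ) (M : ℝ → ℝ) (x : Coord) : Scalar → ℝ
  | const q => q
  | r => x 1
  | c => Real.cos (x 2)
  | s => Real.sin (x 2)
  | w => (rhoSq a x)⁻¹
  | k => Real.cos (x 2) / Real.sin (x 2)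
  | m => M (x 0)
  | m' => deriv M (x 0)
  | m'' => deriv (deriv M) (x 0)
  | add p q => val a M x p + val a M x q
  | mul p q => val a M x p * val a M x q
  | neg p => -val a M x p
  | pow p n => val a M x p ^ n

/-- The value at a point of the partial derivative of an expression with respect to `x μ`. -/
def grad (a : ℝ) (M : ℝ → ℝ) (x : Coord) (μ : Fin 4) : Scalar → ℝ
  | const _ => 0
  | r => ![0, 1, 0, 0] μ
  | c => ![0, 0, -Real.sin (x 2), 0] μ
  | s => ![0, 0, Real.cos (x 2), 0] μ
  | w => ![0, -(2 * x 1 * (rhoSq a x)⁻¹ ^ 2),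
      2 * a ^ 2 * Real.cos (x 2) * Real.sin (x 2) * (rhoSq a x)⁻¹ ^ 2, 0] μ
  | k => ![0, 0, -(1 + (Real.cos (x 2) / Real.sin (x 2)) ^ 2), 0] μ
  | m => ![deriv M (x 0), 0, 0, 0] μ
  | m' => ![deriv (deriv M) (x 0), 0, 0, 0] μ
  | m'' => ![deriv (deriv (deriv M)) (x 0), 0, 0, 0] μ
  | add p q => grad a M x μ p + grad a M x μ q
  | mul p q => grad a M x μ p * val a M x q + val a M x p * grad a M x μ q
  | neg p => -grad a M x μ p
  | pow p n => n * val a M x p ^ (n - 1) * grad a M x μ p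

section simp
variable (a : ℝ) (M : ℝ → ℝ) (x : Coord) (μ : Fin 4) (p q : Scalar) (n : ℕ)

@[simp] theorem val_zero : val a M x 0 = 0 := rfl
@[simp] theorem val_one : val a M x 1 = 1 := rfl
@[simp] theorem val_add : val a M x (p + q) = val a M x p + val a M x q := rfl
@[simp] theorem val_mul : val a M x (p * q) = val a M x p * val a M x q := rfl
@[simp] theorem val_neg : val a M x (-p) = -val a M x p := rfl
@[simp] theorem val_sub : val a M x (p - q) = val a M x p - val a M x q :=
  (sub_eq_add_neg _ _).symm
@[simp] theorem val_pow : val a M x (p ^ n) = val a M x p ^ n := rfl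
@[simp] theorem grad_zero : grad a M x μ 0 = 0 := rfl
@[simp] theorem grad_one : grad a M x μ 1 = 0 := rfl
@[simp] theorem grad_add : grad a M x μ (p + q) = grad a M x μ p + grad a M x μ q := rfl
@[simp] theorem grad_mul :
    grad a M x μ (p * q) = grad a M x μ p * val a M x q + val a M x p * grad a M x μ q := rfl
@[simp] theorem grad_neg : grad a M x μ (-p) = -grad a M x μ p := rfl
@[simp] theorem grad_sub : grad a M x μ (p - q) = grad a M x μ p - grad a M x μ q :=
  (sub_eq_add_neg _ _).symm
@[simp] theorem grad_pow :
    grad a M x μ (p ^ n) = n * val a M x p ^ (n - 1) * grad a M x μ p := rfl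

end simp
end Scalar

theorem rhoSq_pos (a : ℝ) {x : Coord} (hx : x ∈ domain) : 0 < rhoSq a x := by
  have := hx.1
  unfold rhoSq
  positivity

theorem sin_pos_of_mem_domain {x : Coord} (hx : x ∈ domain) : 0 < Real.sin (x 2) :=
  Real.sin_pos_of_pos_of_lt_pi hx.2.1 hx.2.2

theorem isOpen_domain : IsOpen domain := by
  have h (i : Fin 4) : Continuous fun x : Coord => x i := continuous_apply i
  exact (isOpen_lt continuous_const (h 1)).inter
    ((isOpen_lt continuous_const (h 2)).inter (isOpen_lt (h 2) continuous_const))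

/-! ### Formal derivatives are partial derivatives -/

section
variable {a : ℝ} {M : ℝ → ℝ} (hM : ContDiff ℝ 3 M) {x : Coord} (hx : x ∈ domain)
include hM

theorem differentiable_deriv_iterate :
    Differentiable ℝ M ∧ Differentiable ℝ (deriv M) ∧ Differentiable ℝ (deriv (deriv M)) := by
  have h1 : ContDiff ℝ 2 (deriv M) := ContDiff.iterate_deriv' 2 1 hM
  have h2 : ContDiff ℝ 1 (deriv (deriv M)) := ContDiff.iterate_deriv' 1 2 hM
  exact ⟨hM.differentiable (by norm_num), h1.differentiable (by norm_num),
    h2.differentiable (by norm_num)⟩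

include hx

/-- Induction on the expression. The atom M'' is where C³ is needed; its derivative M''' is not an
expression, which is why `grad` is real-valued. -/
theorem Scalar.hasDerivAt_val (μ : Fin 4) (p : Scalar) :
    HasDerivAt (fun t => p.val a M (Function.update x μ t)) (p.grad a M x μ) (x μ) := by
  obtain ⟨h0, h1, h2⟩ := differentiable_deriv_iterate hM
  have hρ := (rhoSq_pos a hx).ne'
  have hs := (sin_pos_of_mem_domain hx).ne'
  induction p with
  | const q => exact hasDerivAt_const _ _
  | r => fin_cases μ <;> simp [val, grad, hasDerivAt_const, hasDerivAt_id']
  | c => fin_cases μ <;> simp [val, grad, hasDerivAt_const, Real.hasDerivAt_cos]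
  | s => fin_cases μ <;> simp [val, grad, hasDerivAt_const, Real.hasDerivAt_sin]
  | w =>
    fin_cases μ
    · simp [val, grad, rhoSq, hasDerivAt_const]
    · have h := (((hasDerivAt_id' (x 1)).pow 2).add_const (a ^ 2 * Real.cos (x 2) ^ 2)).inv hρ
      simp only [rhoSq, val, grad] at h ⊢
      convert! h using 1
      simp [field]
    · have h := ((((Real.hasDerivAt_cos (x 2)).pow 2).const_mul (a ^ 2)).const_add
        (x 1 ^ 2)).inv hρ
      simp only [rhoSq, val, grad] at h ⊢
      convert! h using 1
      simp [field]
    · simp [val, grad, rhoSq, hasDerivAt_const]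
  | k =>
    fin_cases μ
    · simp [val, grad, hasDerivAt_const]
    · simp [val, grad, hasDerivAt_const]
    · have h := (Real.hasDerivAt_cos (x 2)).div (Real.hasDerivAt_sin (x 2)) hs
      simp only [val, grad] at h ⊢
      convert! h using 1
      simp [field]
      ring
    · simp [val, grad, hasDerivAt_const]
  | m => fin_cases μ <;> simp [val, grad, hasDerivAt_const, (h0 _).hasDerivAt]
  | m' => fin_cases μ <;> simp [val, grad, hasDerivAt_const, (h1 _).hasDerivAt]
  | m'' => fin_cases μ <;> simp [val, grad, hasDerivAt_const, (h2 _).hasDerivAt]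
  | add p q hp hq => exact hp.add hq
  | mul p q hp hq =>
    have h := hp.mul hq
    rwa [Function.update_eq_self] at h
  | neg p hp => exact hp.neg
  -- The truncated exponent n - 1 is harmless at n = 0, where the factor n vanishes.
  | pow p n hp =>
    have h := hp.pow n
    rwa [Function.update_eq_self] at h

/-- Partial derivatives alone do not give joint differentiability, which the claim about the current
requires. -/
theorem Scalar.differentiableAt_val (p : Scalar) :
    DifferentiableAt ℝ (fun y => p.val a M y) x := by
  obtain ⟨h0, h1, h2⟩ := differentiable_deriv_iterate hM
  have hρ := (rhoSq_pos a hx).ne'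
  have hs := (sin_pos_of_mem_domain hx).ne'
  have hc (i : Fin 4) : DifferentiableAt ℝ (fun y : Coord => y i) x :=
    differentiableAt_apply i x
  induction p with
  | const q => exact differentiableAt_const _
  | r => exact hc 1
  | c => exact (hc 2).cos
  | s => exact (hc 2).sin
  | w => exact (((hc 1).pow 2).add (((hc 2).cos.pow 2).const_mul _)).inv hρ
  | k =>
    simp only [val, div_eq_mul_inv]
    exact (hc 2).cos.mul ((hc 2).sin.fun_inv hs)
  | m => exact (h0 _).comp x (hc 0)
  | m' => exact (h1 _).comp x (hc 0)
  | m'' => exact (h2 _).comp x (hc 0)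
  | add p q hp hq => exact hp.add hq
  | mul p q hp hq => exact hp.mul hq
  | neg p hp => exact hp.neg
  | pow p n hp => exact hp.pow n

theorem pd_eq_grad {f : Coord → ℝ} (p : Scalar) (hf : ∀ y ∈ domain, f y = p.val a M y)
    (μ : Fin 4) : pd μ f x = p.grad a M x μ := by
  have hu : ContinuousAt (fun t => Function.update x μ t) (x μ) := by fun_prop
  -- The domain is open, so the coordinate line through x stays in it near x; the derivative sees
  -- only those values.
  have hd : ∀ᶠ t in nhds (x μ), Function.update x μ t ∈ domain := by
    apply hu.eventually_mem
    rw [Function.update_eq_self]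
    exact isOpen_domain.mem_nhds hx
  exact ((p.hasDerivAt_val hM hx μ).congr_of_eventuallyEq
    (hd.mono fun t ht => hf _ ht)).deriv

end

/-! ### Metric and connection -/

namespace Scalar

/-- The components of the metric. -/
def metric (a : ℝ) : Matrix (Fin 4) (Fin 4) Scalar :=
  let a := const a
  let h := const 2 * m * r * w
  let t := a * s ^ 2
  !![h - 1, 1, 0, -(t * h);
     1, 0, 0, -t;
     0, 0, r ^ 2 + a ^ 2 * c ^ 2, 0;
     -(t * h), -t, 0, (r ^ 2 + a ^ 2) * s ^ 2 + t ^ 2 * h]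

/-- The components of the inverse metric. -/
def invMetric (a : ℝ) : Matrix (Fin 4) (Fin 4) Scalar :=
  let a := const a
  let γ := r ^ 2 + a ^ 2
  let δ := r ^ 2 - const 2 * m * r + a ^ 2
  !![(a * s) ^ 2 * w, γ * w, 0, a * w;
     γ * w, δ * w, 0, a * w;
     0, 0, w, 0;
     a * w, a * w, 0, (1 + k ^ 2) * w]

/-- The Christoffel symbols; the first index is the upper one. -/
def christoffel (a : ℝ) : Fin 4 → Matrix (Fin 4) (Fin 4) Scalar :=
  let a := const a
  let γ := r ^ 2 + a ^ 2
  let δ := r ^ 2 - const 2 * m * r + a ^ 2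
  let t := a * s ^ 2
  let σ := (a * s) ^ 2
  let b := m * (r ^ 2 - a ^ 2 * c ^ 2) * w ^ 2
  let h' := m' * r * w
  let q := const 2 * r * a ^ 2 * c * s * w ^ 2 * m
  let g0 := γ * w * b - h' * σ * w
  let g1 := δ * w * b - h' * σ * w
  let g3 := a * w * b - h' * a * w
  let e := a ^ 2 * c * s * w
  let p := const 2 * r * a * c * s * γ * w ^ 3 * m
  let z := c * s * w * (γ + const 2 * r * m * σ * w * (γ * w + 1))
  let u := const 2 * a * r * m * w ^ 2 * k
  ![!![g0, 0, -q, -(t * g0);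
       0, 0, -e, r * t * w;
       -q, -e, -(r * γ * w), t * q;
       -(t * g0), r * t * w, t * q, t ^ 2 * g0 - r * s ^ 2 * γ * w],
    !![g1 + h', -b, 0, -(t * g1);
       -b, 0, -e, t * (b + r * w);
       0, -e, -(r * δ * w), 0;
       -(t * g1), t * (b + r * w), 0, t ^ 2 * (g1 - h') - r * s ^ 2 * δ * w],
    !![-(w * q), 0, 0, p;
       0, 0, r * w, a * c * s * w;
       0, r * w, -e, 0;
       p, a * c * s * w, 0, -z],
    !![g3, 0, -u, -(t * g3);
       0, 0, -(a * w * k), r * w;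
       -u, -(a * w * k), -(r * a * w), k + q;
       -(t * g3), r * w, k + q, t ^ 2 * g3 - t * r * w]]

end Scalar

section
variable {a : ℝ} {M : ℝ → ℝ} {x : Coord} (hx : x ∈ domain)
include hx

/-- The ψψ entry rests on Γ² - Δ a² sin² ϑ = ρ² Γ + 2 M r a² sin² ϑ. -/
theorem metric_eq_val (i j : Fin 4) : metric a M x i j = (Scalar.metric a i j).val a M x := by
  have hρ := (rhoSq_pos a hx).ne'
  -- Eliminating cos² in both the goal and `hρ` gives ρ² a single form, which `field_simp` can
  -- recognise as nonzero.
  have hc := Real.cos_sq' (x 2)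
  fin_cases i <;> fin_cases j <;>
    simp [metric, Scalar.metric, Scalar.val, hc, rhoSq, Gam, Delta] at hρ ⊢ <;>
    (field_simp; try ring)

theorem invMetric_eq_val (i j : Fin 4) :
    invMetric (metric a M) x i j = (Scalar.invMetric a i j).val a M x := by
  have hρ := (rhoSq_pos a hx).ne'
  have hs := (sin_pos_of_mem_domain hx).ne'
  have hc := Real.cos_sq' (x 2)
  have h : invMetric (metric a M) x = .of fun i j => (Scalar.invMetric a i j).val a M x := by
    refine Matrix.inv_eq_right_inv ?_
    ext i j
    simp only [Matrix.mul_apply, metric_eq_val hx, Matrix.of_apply, Fin.sum_univ_four]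
    fin_cases i <;> fin_cases j <;>
      simp [Scalar.metric, Scalar.invMetric, Scalar.val, div_pow, hc, rhoSq] at hρ ⊢ <;>
      (field_simp; try ring)
  rw [h, Matrix.of_apply]

end

section
variable {a : ℝ} {M : ℝ → ℝ} (hM : ContDiff ℝ 3 M) {x : Coord} (hx : x ∈ domain)
include hx hM

theorem pd_metric (i j μ : Fin 4) :
    pd μ (fun y => metric a M y i j) x = (Scalar.metric a i j).grad a M x μ :=
  pd_eq_grad hM hx _ (fun _ hy => metric_eq_val hy i j) μ

set_option maxHeartbeats 4000000 in
theorem christoffel_eq_val (l : Fin 4) (μ ν : Fin 4) :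
    christoffel (metric a M) l μ ν x = (Scalar.christoffel a l μ ν).val a M x := by
  have hρ := (rhoSq_pos a hx).ne'
  have hs := (sin_pos_of_mem_domain hx).ne'
  have hc := Real.cos_sq' (x 2)
  simp only [christoffel, pd_metric hM hx, invMetric_eq_val hx, Fin.sum_univ_four]
  fin_cases l <;> fin_cases μ <;> fin_cases ν <;>
    simp [Scalar.metric, Scalar.invMetric, Scalar.christoffel, Scalar.val, Scalar.grad, div_pow,
      rhoSq, hc] at hρ ⊢ <;>
    (field_simp; try ring)

end

/-! ### Ricci tensor -/

/-- The components of the Ricci tensor. -/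
def Scalar.ricci (a : ℝ) : Matrix (Fin 4) (Fin 4) Scalar :=
  let a := const a
  let t := a * s ^ 2
  let σ := (a * s) ^ 2
  let e := (r ^ 2 - a ^ 2 * c ^ 2) * w ^ 2 * m'
  let j := const 2 * r ^ 2 * w ^ 2 * m' + const 2 * σ * w * e - r * σ * w ^ 2 * m''
  let q := -(const 2 * r * a ^ 2 * c * s * w ^ 2 * m')
  !![j, 0, q, -(t * (j + e));
     0, 0, 0, 0;
     q, 0, 0, -(t * q);
     -(t * (j + e)), 0, -(t * q), t ^ 2 * (j + const 2 * e)]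

/-- The components of the current associated with `∂/∂v`. -/
def Scalar.current (a : ℝ) : Fin 4 → Scalar :=
  let a := const a
  let σ := (a * s) ^ 2
  let ρ := r ^ 2 + a ^ 2 * c ^ 2
  let e := a ^ 2 * c ^ 2 - r ^ 2
  ![w ^ 3 * (σ * e * m'),
    w ^ 3 * ((ρ ^ 2 + r ^ 4 + r ^ 2 * σ - a ^ 4 * c ^ 2) * m' - r * ρ * σ * m''),
    -(w ^ 3 * (r * a ^ 2 * (const 2 * s * c) * m')),
    w ^ 3 * (a * e * m')]

section
variable {a : ℝ} {M : ℝ → ℝ} (hM : ContDiff ℝ 3 M) {x : Coord} (hx : x ∈ domain)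
include hx hM

theorem pd_christoffel (l i j μ : Fin 4) :
    pd μ (christoffel (metric a M) l i j) x = (Scalar.christoffel a l i j).grad a M x μ :=
  pd_eq_grad hM hx _ (fun _ hy => christoffel_eq_val hM hy l i j) μ

set_option maxHeartbeats 8000000 in
theorem ricci_eq_val (μ ν : Fin 4) :
    ricci (metric a M) μ ν x = (Scalar.ricci a μ ν).val a M x := by
  have hρ := (rhoSq_pos a hx).ne'
  have hs := (sin_pos_of_mem_domain hx).ne'
  have hc := Real.cos_sq' (x 2)
  simp only [ricci, riemann, pd_christoffel hM hx, christoffel_eq_val hM hx, Fin.sum_univ_four]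
  fin_cases μ <;> fin_cases ν <;>
    simp [Scalar.ricci, Scalar.christoffel, Scalar.val, Scalar.grad, div_pow, rhoSq, hc] at hρ ⊢ <;>
    -- Normalising merges products of cosines into new squares, so cos² is eliminated a second time.
    field_simp <;> ring_nf <;> (try simp only [hc]) <;> ring

end

/-! ### The current and the divergences -/

section
variable {a : ℝ} {M : ℝ → ℝ} (hM : ContDiff ℝ 3 M) {x : Coord} (hx : x ∈ domain)
include hx hM

/-- In the notation of `Scalar.ricci`, the vv, vψ and ψψ terms add up to (a² sin² ϑ / ρ²)(j - 2(j +
e) + (j + 2e)) = 0; the other nonzero Ricci components meet zeros of the inverse metric. -/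
theorem scalarCurv_eq_zero : scalarCurv (metric a M) x = 0 := by
  have hρ := (rhoSq_pos a hx).ne'
  have hs := (sin_pos_of_mem_domain hx).ne'
  have hc := Real.cos_sq' (x 2)
  simp only [scalarCurv, invMetric_eq_val hx, ricci_eq_val hM hx, Fin.sum_univ_four]
  simp [Scalar.ricci, Scalar.invMetric, Scalar.val, div_pow, rhoSq, hc] at hρ ⊢
  field_simp
  ring

theorem current_eq_val (μ : Fin 4) :
    current (metric a M) K x μ = (Scalar.current a μ).val a M x := by
  have hρ := (rhoSq_pos a hx).ne'
  have hs := (sin_pos_of_mem_domain hx).ne'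
  have hc := Real.cos_sq' (x 2)
  have hK (ν : Fin 4) : lower (metric a M) K ν x = (Scalar.metric a ν 0).val a M x := by
    simp [lower, K, ← metric_eq_val hx, Pi.single_apply]
  simp only [current, einsteinUp, einstein, scalarCurv_eq_zero hM hx, hK, invMetric_eq_val hx,
    ricci_eq_val hM hx, Fin.sum_univ_four]
  fin_cases μ <;>
    simp [Scalar.ricci, Scalar.invMetric, Scalar.metric, Scalar.current, Scalar.val, div_pow,
      rhoSq, hc] at hρ ⊢ <;>
    field_simp <;> ring

theorem differentiableAt_current :
    DifferentiableAt ℝ (current (metric a M) K) x := by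
  refine differentiableAt_pi.2 fun μ => ?_
  refine (Scalar.differentiableAt_val (a := a) hM hx (Scalar.current a μ)).congr_of_eventuallyEq ?_
  filter_upwards [isOpen_domain.mem_nhds hx] with y hy
  exact current_eq_val hM hy μ

/-- The trace `Γ^μ_{μl}` of the Christoffel symbols is `∂_l log (ρ² sin ϑ)`. -/
theorem sum_christoffel (l : Fin 4) :
    ∑ μ, christoffel (metric a M) μ μ l x =
      ![0, 2 * x 1 / rhoSq a x,
        Real.cos (x 2) / Real.sin (x 2)
          - 2 * a ^ 2 * Real.cos (x 2) * Real.sin (x 2) / rhoSq a x, 0] l := by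
  have hρ := (rhoSq_pos a hx).ne'
  have hs := (sin_pos_of_mem_domain hx).ne'
  have hc := Real.cos_sq' (x 2)
  simp only [christoffel_eq_val hM hx, Fin.sum_univ_four]
  fin_cases l <;>
    simp [Scalar.christoffel, Scalar.val, rhoSq, hc] at hρ ⊢ <;>
    field_simp <;> ring

/-- The density ρ² sin ϑ depends on r and ϑ only, so just these two components of V receive a
correction. -/
theorem divergence_eq {V : VField} (p : Fin 4 → Scalar)
    (hV : ∀ y ∈ domain, ∀ μ, V y μ = (p μ).val a M y) :
    divergence (metric a M) V x = ∑ μ, (p μ).grad a M x μ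
      + 2 * x 1 / rhoSq a x * (p 1).val a M x
      + (Real.cos (x 2) / Real.sin (x 2)
          - 2 * a ^ 2 * Real.cos (x 2) * Real.sin (x 2) / rhoSq a x) * (p 2).val a M x := by
  have h (μ : Fin 4) : pd μ (fun y => V y μ) x = (p μ).grad a M x μ :=
    pd_eq_grad hM hx _ (fun y hy => hV y hy μ) μ
  simp only [divergence, covDeriv, h, hV x hx, Finset.sum_add_distrib]
  rw [Finset.sum_comm]
  simp only [← Finset.sum_mul, sum_christoffel hM hx]
  simp [Fin.sum_univ_four]
  ring

theorem divergence_current : divergence (metric a M) (current (metric a M) K) x = 0 := by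
  have hρ := (rhoSq_pos a hx).ne'
  have hs := (sin_pos_of_mem_domain hx).ne'
  have hc := Real.cos_sq' (x 2)
  rw [divergence_eq hM hx (Scalar.current a) fun y hy => current_eq_val hM hy]
  simp [Fin.sum_univ_four, Scalar.current, Scalar.val, Scalar.grad, rhoSq, hc] at hρ ⊢
  field_simp
  ring_nf
  simp only [hc]
  ring

theorem divergence_K : divergence (metric a M) K x = 0 := by
  rw [divergence_eq hM hx (Pi.single 0 1)]
  · simp [Fin.sum_univ_four, Pi.single_apply]
  · intro y _ μ
    fin_cases μ <;> simp [K]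

end

theorem along_K (x : Coord) : along K (fun y => y 1) x = 0 := by
  simp [along, K, pd, Fin.sum_univ_four]

theorem normSq_K_neg_iff (a : ℝ) (M : ℝ → ℝ) {x : Coord} (hx : x ∈ domain) :
    normSq (metric a M) K x < 0 ↔ 2 * M (x 0) * x 1 < rhoSq a x := by
  have h : normSq (metric a M) K x = 2 * M (x 0) * x 1 / rhoSq a x - 1 := by
    simp [normSq, K, metric, Pi.single_apply]
  rw [h, sub_neg, div_lt_one (rhoSq_pos a hx)]

end KerrVaidya

end

theorem proposition1 (a : ℝ) (M : ℝ → ℝ) (hM : ContDiff ℝ 3 M)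
    (x : KerrVaidya.Coord) (hx : x ∈ KerrVaidya.domain) :
    -- `K` is divergence-free
    KerrVaidya.divergence (KerrVaidya.metric a M) KerrVaidya.K x = 0 ∧
    -- `K` is tangent to the surfaces of constant `r`
    KerrVaidya.along KerrVaidya.K (fun y => y 1) x = 0 ∧
    -- the current `J^a = G^{ab} K_b` is covariantly conserved
    DifferentiableAt ℝ (KerrVaidya.current (KerrVaidya.metric a M) KerrVaidya.K) x ∧
    KerrVaidya.divergence (KerrVaidya.metric a M)
      (KerrVaidya.current (KerrVaidya.metric a M) KerrVaidya.K) x = 0 ∧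
    -- the components of the current
    KerrVaidya.current (KerrVaidya.metric a M) KerrVaidya.K x 0 =
      1 / KerrVaidya.rhoSq a x ^ 3 * (a ^ 2 * Real.sin (x 2) ^ 2 *
        (a ^ 2 * Real.cos (x 2) ^ 2 - x 1 ^ 2) * deriv M (x 0)) ∧
    KerrVaidya.current (KerrVaidya.metric a M) KerrVaidya.K x 1 =
      1 / KerrVaidya.rhoSq a x ^ 3 *
        ((KerrVaidya.rhoSq a x ^ 2 + x 1 ^ 4 + x 1 ^ 2 * a ^ 2 * Real.sin (x 2) ^ 2
            - a ^ 4 * Real.cos (x 2) ^ 2) * deriv M (x 0)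
          - x 1 * KerrVaidya.rhoSq a x * a ^ 2 * Real.sin (x 2) ^ 2 *
            deriv (deriv M) (x 0)) ∧
    KerrVaidya.current (KerrVaidya.metric a M) KerrVaidya.K x 2 =
      -(1 / KerrVaidya.rhoSq a x ^ 3 *
        (x 1 * a ^ 2 * Real.sin (2 * x 2) * deriv M (x 0))) ∧
    KerrVaidya.current (KerrVaidya.metric a M) KerrVaidya.K x 3 =
      1 / KerrVaidya.rhoSq a x ^ 3 *
        (a * (a ^ 2 * Real.cos (x 2) ^ 2 - x 1 ^ 2) * deriv M (x 0)) ∧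
    -- `K` is timelike exactly where `2 M(v) r < ρ²`
    (KerrVaidya.normSq (KerrVaidya.metric a M) KerrVaidya.K x < 0 ↔
      2 * M (x 0) * x 1 < KerrVaidya.rhoSq a x) := by
  refine ⟨KerrVaidya.divergence_K hM hx, KerrVaidya.along_K x,
    KerrVaidya.differentiableAt_current hM hx, KerrVaidya.divergence_current hM hx,
    ?_, ?_, ?_, ?_, KerrVaidya.normSq_K_neg_iff a M hx⟩ <;>
  · rw [KerrVaidya.current_eq_val hM hx]
    simp [-mul_eq_mul_left_iff, KerrVaidya.Scalar.current, KerrVaidya.Scalar.val,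
      Real.sin_two_mul, KerrVaidya.rhoSq]
    try ring
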